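/- Let $n\ge 0$ and let $\wedge^2\mathbb R^n$ carry the inner product for which $\{e_i\wedge e_j\}_{i<j}$ is orthonormal, identified with $\mathfrak{so}(n)$ by $e_i\wedge e_j\mapsto E_{ij}$, where $E_{ij}$ is the matrix with $(i,j)$ entry $+1$, $(j,i)$ entry $-1$ and all other entries zero. Let $R\colon\wedge^2\mathbb R^n\to\wedge^2\mathbb R^n$ be a self-adjoint linear operator (the first Bianchi identity is not required), and write $\sec_R\ge k$ (resp. $\sec_R\le k$) if $\langle R(x\wedge y),x\wedge y\rangle\ge k$ (resp. $\le k$) for all orthonormal $x,y\in\mathbb R^n$. Let $\mathrm{Sym}^p_0\mathbb R^n$ be the space of harmonic homogeneous polynomials of degree $p$ on $\mathbb R^n$, with the inner product $\langle\varphi,\psi\rangle=\widehat\varphi(\psi)$, where $\widehat\varphi$ is the differential operator obtained from $\varphi$ by replacing each $x_i$ with $\partial/\partial x_i$, and let $\mathrm d\rho\colon\mathfrak{so}(n)\to\mathrm{End}(\mathrm{Sym}^p_0\mathbb R^n)$ be the linearization of $\rho(A)\varphi=\varphi\circ A^{-1}$, $A\in\mathrm O(n)$, so that $\mathrm d\rho(E_{ij})=x_i\partial_{x_j}-x_j\partial_{x_i}$.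 Set $$\mathcal K(R,\mathrm{Sym}^p_0\mathbb R^n)=-\sum_{a,b}\langle R(X_a),X_b\rangle\,\mathrm d\rho(X_a)\,\mathrm d\rho(X_b),$$ where $\{X_a\}$ is an orthonormal basis of $\wedge^2\mathbb R^n\cong\mathfrak{so}(n)$. Then for every $k\in\mathbb R$: 1. $\sec_R\ge k$ if and only if the self-adjoint endomorphism $\mathcal K(R-k\,\mathrm{Id},\mathrm{Sym}^p_0\mathbb R^n)$ is positive-semidefinite for all $p\ge2$; 2. $\sec_R\le k$ if and only if $\mathcal K(R-k\,\mathrm{Id},\mathrm{Sym}^p_0\mathbb R^n)$ is negative-semidefinite for all $p\ge2$. -/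

import Mathlib

noncomputable section

namespace WeitzenbockSym

open MvPolynomial

/-- Euclidean space `ℝⁿ`, with orthonormal basis `e₀, …, eₙ₋₁`. -/
abbrev Euc (n : ℕ) : Type := EuclideanSpace ℝ (Fin n)

/-- The second exterior power `∧²ℝⁿ`, with the Gram determinant inner product, for which the
`eᵢ ∧ eⱼ` with `i < j` form an orthonormal basis. -/
abbrev Wedge2 (n : ℕ) : Type := ⋀[ℝ]^2 (Euc n)

/-- The decomposable element `x ∧ y` of `∧²ℝⁿ`. -/
def wedge {n : ℕ} (x y : Euc n) : Wedge2 n := exteriorPower.ιMulti ℝ 2 ![x, y]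

/-! ### Sectional curvature -/

/-- `sec_R ≥ k`: one has `⟨R σ, σ⟩ ≥ k` for every 2-plane, where `σ = x ∧ y` for an orthonormal
basis `x, y` of the plane. -/
def SecGE {n : ℕ} (R : Module.End ℝ (Wedge2 n)) (k : ℝ) : Prop :=
  ∀ x y : Euc n, Orthonormal ℝ ![x, y] → k ≤ inner ℝ (R (wedge x y)) (wedge x y)

/-- `sec_R ≤ k`. -/
def SecLE {n : ℕ} (R : Module.End ℝ (Wedge2 n)) (k : ℝ) : Prop :=
  ∀ x y : Euc n, Orthonormal ℝ ![x, y] → inner ℝ (R (wedge x y)) (wedge x y) ≤ k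

/-! ### The identification of `∧²ℝⁿ` with `𝔰𝔬(n)` -/

/-- The Lie algebra `𝔰𝔬(n)` of skew-symmetric matrices. -/
abbrev SO (n : ℕ) := LieAlgebra.Orthogonal.so (Fin n) ℝ

/-- The alternating map `(v, w) ↦ v wᵀ - w vᵀ` with values in `𝔰𝔬(n)`. -/
def skewOfPair (n : ℕ) : (Euc n) [⋀^Fin 2]→ₗ[ℝ] (SO n) where
  toFun v := ⟨Matrix.of fun i j => v 0 i * v 1 j - v 1 i * v 0 j, by
    rw [LieAlgebra.Orthogonal.mem_so]
    ext i j
    simp [mul_comm]⟩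
  map_update_add' v i x y := by
    apply Subtype.ext
    ext a b
    fin_cases i <;> simp [Function.update] <;> ring
  map_update_smul' v i c x := by
    apply Subtype.ext
    ext a b
    fin_cases i <;> simp [Function.update] <;> ring
  map_eq_zero_of_eq' v i j h hij := by
    have h01 : v 0 = v 1 := by
      fin_cases i <;> fin_cases j <;> simp_all
    apply Subtype.ext
    ext a b
    simp [h01]

/-- The canonical linear map `∧²ℝⁿ → 𝔰𝔬(n)` with `eᵢ ∧ eⱼ ↦ Eᵢⱼ`, the matrix with `(i, j)` entry
`+1`, `(j, i)` entry `-1` and all other entries zero. -/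
def wedgeToSO (n : ℕ) : Wedge2 n →ₗ[ℝ] SO n :=
  exteriorPower.alternatingMapLinearEquiv (skewOfPair n)

/-! ### The curvature term of the Weitzenböck formula -/

/-- The orthonormal basis `(eᵢ ∧ eⱼ)_{i < j}` of `∧²ℝⁿ`. -/
def wedgeBasis (n : ℕ) : OrthonormalBasis (Set.powersetCard (Fin n) 2) ℝ (Wedge2 n) :=
  (EuclideanSpace.basisFun (Fin n) ℝ).exteriorPower 2

/-- The curvature term `𝒦(R, ρ) = - ∑ R_{ab} dρ(X_a) dρ(X_b)`, where `(X_a)` is an orthonormal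
basis of `𝔰𝔬(n) ≅ ∧²ℝⁿ` and `R = ∑ R_{ab} X_a ⊗ X_b`, that is, `R_{ab} = ⟨R X_a, X_b⟩`. It depends
on the representation `ρ` only through its linearization `dρ`. -/
def curvatureTerm {n : ℕ} {V : Type*} [AddCommGroup V] [Module ℝ V]
    (R : Module.End ℝ (Wedge2 n)) (dρ : SO n →ₗ[ℝ] Module.End ℝ V) : Module.End ℝ V :=
  -∑ a, ∑ b, inner ℝ (R (wedgeBasis n a)) (wedgeBasis n b) •
    (dρ (wedgeToSO n (wedgeBasis n a)) * dρ (wedgeToSO n (wedgeBasis n b)))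

/-! ### Traceless symmetric tensors as harmonic homogeneous polynomials -/

/-- The partial derivative `∂/∂xᵢ` as a linear endomorphism of the polynomial ring. -/
def partialD {n : ℕ} (i : Fin n) : Module.End ℝ (MvPolynomial (Fin n) ℝ) :=
  (pderiv i).toLinearMap

/-- The Laplacian `∑ᵢ ∂²/∂xᵢ²` on polynomials. -/
def laplacian (n : ℕ) : Module.End ℝ (MvPolynomial (Fin n) ℝ) :=
  ∑ i : Fin n, partialD i * partialD i

/-- `Sym^p_0 ℝⁿ`: the harmonic homogeneous polynomials of degree `p` on `ℝⁿ`. -/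
def Sym0 (n p : ℕ) : Submodule ℝ (MvPolynomial (Fin n) ℝ) :=
  homogeneousSubmodule (Fin n) ℝ p ⊓ LinearMap.ker (laplacian n)

/-- The action of a matrix `A` on polynomials by the Leibniz rule: the derivation
`∑ᵢⱼ Aⱼᵢ xⱼ ∂/∂xᵢ`, which on linear forms (identified with vectors through `eᵢ ↔ xᵢ`) is
`v ↦ A v`. For `A = Eᵢⱼ` it is `xᵢ ∂/∂xⱼ - xⱼ ∂/∂xᵢ`. -/
def leibniz {n : ℕ} (A : Matrix (Fin n) (Fin n) ℝ) : Module.End ℝ (MvPolynomial (Fin n) ℝ) :=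
  ∑ i, ∑ j, A j i • (LinearMap.mulLeft ℝ (X j) * partialD i)

theorem leibniz_apply {n : ℕ} (A : Matrix (Fin n) (Fin n) ℝ) (φ : MvPolynomial (Fin n) ℝ) :
    leibniz A φ = ∑ i, ∑ j, A j i • (X j * pderiv i φ) := by
  simp [leibniz, partialD]

theorem partialD_comm {n : ℕ} (i j : Fin n) (φ : MvPolynomial (Fin n) ℝ) :
    pderiv i (pderiv j φ) = pderiv j (pderiv i φ) := by
  have h : ⁅pderiv (R := ℝ) i, pderiv (R := ℝ) j⁆ = 0 := by
    apply derivation_ext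
    intro k
    classical
    simp only [Derivation.commutator_apply, pderiv_X, Pi.single_apply]
    split_ifs <;> simp
  have h2 := DFunLike.congr_fun h φ
  rw [Derivation.commutator_apply] at h2
  exact sub_eq_zero.mp h2

theorem pderiv_leibniz {n : ℕ} (A : Matrix (Fin n) (Fin n) ℝ) (k : Fin n)
    (φ : MvPolynomial (Fin n) ℝ) :
    pderiv k (leibniz A φ) = leibniz A (pderiv k φ) + ∑ i, A k i • pderiv i φ := by
  classical
  simp only [leibniz_apply, map_sum, Derivation.map_smul, pderiv_mul, pderiv_X, smul_add,
    Finset.sum_add_distrib, partialD_comm k]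
  rw [add_comm]
  congr 1
  refine Finset.sum_congr rfl fun i _ => ?_
  rw [Finset.sum_eq_single k]
  · simp
  · intro b _ hb
    simp [hb.symm]
  · simp

/-- Skew-symmetric matrices preserve the traceless symmetric tensors. -/
theorem leibniz_mem_Sym0 {n p : ℕ} (A : SO n) {φ : MvPolynomial (Fin n) ℝ}
    (hφ : φ ∈ Sym0 n p) : leibniz (A : Matrix (Fin n) (Fin n) ℝ) φ ∈ Sym0 n p := by
  obtain ⟨A, hA⟩ := A
  rw [LieAlgebra.Orthogonal.mem_so] at hA
  obtain ⟨h1, h2⟩ := hφ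
  refine ⟨?_, ?_⟩
  · change leibniz A φ ∈ homogeneousSubmodule (Fin n) ℝ p
    rw [leibniz_apply]
    refine Submodule.sum_mem _ fun i _ => Submodule.sum_mem _ fun j _ =>
      Submodule.smul_mem _ _ ?_
    rw [mem_homogeneousSubmodule]
    have h1' : φ.IsHomogeneous p := h1
    rcases Nat.eq_zero_or_pos p with rfl | hp
    · have hc : φ.totalDegree = 0 := Nat.le_zero.mp h1'.totalDegree_le
      rw [totalDegree_eq_zero_iff_eq_C] at hc
      rw [hc, pderiv_C, mul_zero]
      exact isHomogeneous_zero _ _ _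
    · have := (isHomogeneous_X ℝ j).mul (h1'.pderiv (i := i))
      rwa [show 1 + (p - 1) = p by omega] at this
  · have h2' : ∑ k, pderiv k (pderiv k φ) = 0 := by
      simpa [laplacian, partialD] using h2
    have hL : ∑ k, leibniz A (pderiv k (pderiv k φ)) = 0 := by
      rw [← map_sum, h2', map_zero]
    have hS : ∑ k, ∑ i, A k i • pderiv k (pderiv i φ) = 0 := by
      have e : ∑ k, ∑ i, A k i • pderiv k (pderiv i φ)
          = -∑ k, ∑ i, A k i • pderiv k (pderiv i φ) := by
        conv_lhs => rw [Finset.sum_comm]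
        simp only [← Finset.sum_neg_distrib]
        refine Finset.sum_congr rfl fun i _ => Finset.sum_congr rfl fun k _ => ?_
        have : A k i = - A i k := by
          have := congrFun (congrFun hA i) k
          simpa using this
        rw [this, partialD_comm, neg_smul]
      exact self_eq_neg.mp e
    change leibniz A φ ∈ LinearMap.ker (laplacian n)
    rw [LinearMap.mem_ker]
    have : laplacian n (leibniz A φ) = ∑ k, pderiv k (pderiv k (leibniz A φ)) := by
      simp [laplacian, partialD]
    rw [this]
    simp only [pderiv_leibniz, map_add, map_sum, Derivation.map_smul, Finset.sum_add_distrib]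
    have hS' : ∑ k, ∑ i, A k i • pderiv i (pderiv k φ) = 0 := by
      simpa only [partialD_comm] using hS
    rw [hL, hS, hS', add_zero, add_zero]

/-- The linearization `dρ` of the representation `ρ` of `O(n)` on `Sym^p_0 ℝⁿ` that is given by
`ρ(A)(v₁ ∨ ⋯ ∨ v_p) = A v₁ ∨ ⋯ ∨ A v_p`, that is, by `ρ(A) φ = φ ∘ A⁻¹`. -/
def dRhoSym0 (n p : ℕ) : SO n →ₗ[ℝ] Module.End ℝ (Sym0 n p) where
  toFun A := (leibniz (A : Matrix (Fin n) (Fin n) ℝ)).restrict fun _ h => leibniz_mem_Sym0 A h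
  map_add' A B := by
    ext φ : 2
    simp [leibniz, add_smul, Finset.sum_add_distrib, LinearMap.restrict_apply]
  map_smul' c A := by
    ext φ : 2
    simp [leibniz, mul_smul, Finset.smul_sum, LinearMap.restrict_apply]

/-- The curvature term `𝒦(R, Sym^p_0 ℝⁿ)`. -/
def curvatureTermSym0 {n : ℕ} (R : Module.End ℝ (Wedge2 n)) (p : ℕ) :
    Module.End ℝ (Sym0 n p) :=
  curvatureTerm R (dRhoSym0 n p)

/-! ### The inner product on symmetric tensors -/

/-- The differential operator `∂^m = ∏ᵢ (∂/∂xᵢ)^{mᵢ}`. -/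
def partialMonomial {n : ℕ} (m : Fin n →₀ ℕ) : Module.End ℝ (MvPolynomial (Fin n) ℝ) :=
  (List.ofFn fun i : Fin n => partialD i ^ m i).prod

/-- The differential operator dual to the polynomial `φ`, obtained by replacing each `xᵢ` with
`∂/∂xᵢ`. -/
def dualOperator {n : ℕ} (φ : MvPolynomial (Fin n) ℝ) : Module.End ℝ (MvPolynomial (Fin n) ℝ) :=
  ∑ m ∈ φ.support, φ.coeff m • partialMonomial m

/-- The inner product of homogeneous polynomials of equal degree: the number obtained by applying
the operator dual to `φ` to `ψ` (the result is then a constant polynomial). -/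
def symInner {n : ℕ} (φ ψ : MvPolynomial (Fin n) ℝ) : ℝ :=
  constantCoeff (dualOperator φ ψ)

/-- An endomorphism of `Sym^p_0 ℝⁿ` is positive-semidefinite: it is self-adjoint and
`⟨T φ, φ⟩ ≥ 0` for all `φ`. -/
def IsPosSemidef {n p : ℕ} (T : Module.End ℝ (Sym0 n p)) : Prop :=
  (∀ φ ψ : Sym0 n p, symInner (T φ).1 ψ.1 = symInner φ.1 (T ψ).1) ∧
    ∀ φ : Sym0 n p, 0 ≤ symInner (T φ).1 φ.1

/-- An endomorphism of `Sym^p_0 ℝⁿ` is negative-semidefinite: it is self-adjoint and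
`⟨T φ, φ⟩ ≤ 0` for all `φ`. -/
def IsNegSemidef {n p : ℕ} (T : Module.End ℝ (Sym0 n p)) : Prop :=
  (∀ φ ψ : Sym0 n p, symInner (T φ).1 ψ.1 = symInner φ.1 (T ψ).1) ∧
    ∀ φ : Sym0 n p, symInner (T φ).1 φ.1 ≤ 0

end WeitzenbockSym

end

noncomputable section

namespace WeitzenbockSym

open MvPolynomial MeasureTheory ProbabilityTheory

/-! Write `L_a = dρ(X_a)`. Each `L_a` is skew for the Fischer product (`fischer_leibniz`), so `⟨𝒦φ,
φ⟩ = ∑ R_{ab} ⟨L_a φ, L_b φ⟩`; symmetry of `𝒦` follows from that of `R`.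

For sec ≥ 0 ⇒ 𝒦 ≥ 0: on harmonic polynomials of one degree the Fischer product is the Gaussian `L²`
product (`gaussianMean_mul`). Since `(L_a φ)(w) = ⟨X_a, w ∧ ∇φ(w)⟩`, the form `⟨𝒦φ, φ⟩` is the
Gaussian mean of `⟨R(w ∧ ∇φ(w)), w ∧ ∇φ(w)⟩`. Only decomposable bivectors occur, so the integrand is
nonnegative.

For the converse, take orthonormal `u, v` and let `ℓ = ⟨u, ·⟩ + i⟨v, ·⟩`. The vector `u + iv` is
isotropic, so the real and imaginary parts of `ℓ^(p+2)` are harmonic. The sum of `𝒦` on the two is a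
positive factor times `T + 2(p+1)⟨R(v ∧ u), v ∧ u⟩` with `T` independent of `p`
(`fischer_rotated_planePow`). Large `p` forces the curvature to be nonnegative.

Replacing `R` by `R - k Id` gives general `k`, and replacing `R` by `-R` gives the upper bound. -/

/-! ### The Fischer form and skewness of `dρ`. -/

theorem coeff_partialD_pow {n : ℕ} (i : Fin n) (k : ℕ) (ψ : MvPolynomial (Fin n) ℝ)
    (d : Fin n →₀ ℕ) (hd : d i = 0) :
    coeff d ((partialD i ^ k) ψ) = k.factorial * coeff (d + Finsupp.single i k) ψ := by
  induction k generalizing ψ with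
  | zero => simp
  | succ k ih =>
    rw [pow_succ, Module.End.mul_apply, ih]
    simp only [partialD, Derivation.coeFn_coe, coeff_pderiv]
    rw [add_assoc, ← Finsupp.single_add, Nat.factorial_succ]
    simp [hd]
    ring

/-- Since the variables are distinct and `d` vanishes on them, each derivative raises an exponent
from zero and contributes exactly `(m i)!`. Allowing `d ≠ 0` off the list lets the induction carry
the exponents already raised. -/
theorem coeff_partialD_list_prod {n : ℕ} (m : Fin n →₀ ℕ) (l : List (Fin n)) (hl : l.Nodup)
    (ψ : MvPolynomial (Fin n) ℝ) (d : Fin n →₀ ℕ) (hd : ∀ i ∈ l, d i = 0) :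
    coeff d ((l.map fun i => partialD i ^ m i).prod ψ) =
      (l.map fun i => ((m i).factorial : ℝ)).prod *
        coeff (d + (l.map fun i => Finsupp.single i (m i)).sum) ψ := by
  induction l generalizing d with
  | nil => simp
  | cons i l ih =>
    rw [List.nodup_cons] at hl
    simp only [List.map_cons, List.prod_cons, List.sum_cons, Module.End.mul_apply]
    rw [coeff_partialD_pow i _ _ _ (hd i (by simp)), ih hl.2, add_assoc, mul_assoc]
    intro j hj
    have hij : i ≠ j := fun h => hl.1 (h ▸ hj)
    simp [hd j (by simp [hj]), hij]

theorem constantCoeff_partialMonomial {n : ℕ} (m : Fin n →₀ ℕ) (ψ : MvPolynomial (Fin n) ℝ) :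
    constantCoeff (partialMonomial m ψ) = (∏ i, ((m i).factorial : ℝ)) * coeff m ψ := by
  have h := coeff_partialD_list_prod m (List.finRange n) (List.nodup_finRange n) ψ 0 (by simp)
  rw [partialMonomial, List.ofFn_eq_map, constantCoeff_eq, h, zero_add, ← List.ofFn_eq_map,
    ← List.ofFn_eq_map, List.prod_ofFn, List.sum_ofFn, Finsupp.univ_sum_single]

/-- The Fischer bilinear form on all polynomials: monomials `x^m` are orthogonal, of square
length `m!`. -/
def fischer (n : ℕ) : MvPolynomial (Fin n) ℝ →ₗ[ℝ] MvPolynomial (Fin n) ℝ →ₗ[ℝ] ℝ :=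
  (basisMonomials (Fin n) ℝ).constr ℝ fun m => (∏ i, ((m i).factorial : ℝ)) • lcoeff ℝ m

theorem fischer_monomial {n : ℕ} (m : Fin n →₀ ℕ) (c : ℝ) (ψ : MvPolynomial (Fin n) ℝ) :
    fischer n (monomial m c) ψ = c * ((∏ i, ((m i).factorial : ℝ)) * coeff m ψ) := by
  have h : monomial m c = c • basisMonomials (Fin n) ℝ m := by simp [smul_monomial]
  rw [h, map_smul, fischer, Module.Basis.constr_basis]
  simp

/-- A sum over the support hides linearity in the first argument; passing to `fischer` makes it
available. -/
theorem symInner_eq_fischer {n : ℕ} (φ ψ : MvPolynomial (Fin n) ℝ) :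
    symInner φ ψ = fischer n φ ψ := by
  conv_rhs => rw [φ.as_sum]
  simp only [symInner, dualOperator, map_sum, LinearMap.sum_apply, fischer_monomial]
  refine Finset.sum_congr rfl fun m _ => ?_
  rw [LinearMap.smul_apply, constantCoeff_smul, constantCoeff_partialMonomial, smul_eq_mul]

theorem fischer_comm {n : ℕ} (φ ψ : MvPolynomial (Fin n) ℝ) :
    fischer n φ ψ = fischer n ψ φ := by
  classical
  induction φ using MvPolynomial.induction_on' with
  | add p q hp hq => simp [hp, hq]
  | monomial u a =>
    induction ψ using MvPolynomial.induction_on' with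
    | add p q hp hq => rw [map_add, map_add, LinearMap.add_apply, hp, hq]
    | monomial v b =>
      rw [fischer_monomial, fischer_monomial, coeff_monomial, coeff_monomial]
      by_cases h : u = v
      · subst h
        simp only [if_true]
        ring
      · simp [h, Ne.symm h]

/-- On monomials this is `(m + e_i)! = m! (m_i + 1)`. -/
theorem fischer_X_mul {n : ℕ} (i : Fin n) (φ ψ : MvPolynomial (Fin n) ℝ) :
    fischer n (X i * φ) ψ = fischer n φ (pderiv i ψ) := by
  induction φ using MvPolynomial.induction_on' with
  | add p q hp hq => simp [mul_add, hp, hq]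
  | monomial m c =>
    have hX : X i * monomial m c = monomial (m + Finsupp.single i 1) c := by
      rw [X, monomial_mul, one_mul, add_comm]
    have hf : ∏ j, (((m + Finsupp.single i 1 : Fin n →₀ ℕ) j).factorial : ℝ)
        = (∏ j, ((m j).factorial : ℝ)) * (m i + 1) := by
      rw [← Finset.mul_prod_erase _ _ (Finset.mem_univ i),
        ← Finset.mul_prod_erase Finset.univ (fun j => ((m j).factorial : ℝ)) (Finset.mem_univ i)]
      have he : ∏ j ∈ Finset.univ.erase i, (((m + Finsupp.single i 1 : Fin n →₀ ℕ) j).factorial : ℝ)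
          = ∏ j ∈ Finset.univ.erase i, ((m j).factorial : ℝ) :=
        Finset.prod_congr rfl fun j hj => by
          simp [(Finset.ne_of_mem_erase hj).symm]
      rw [he]
      simp [Nat.factorial_succ]
      ring
    rw [hX, fischer_monomial, fischer_monomial, coeff_pderiv, hf]
    ring

theorem fischer_mul_X {n : ℕ} (i : Fin n) (φ ψ : MvPolynomial (Fin n) ℝ) :
    fischer n φ (X i * ψ) = fischer n (pderiv i φ) ψ := by
  rw [fischer_comm, fischer_X_mul, fischer_comm]

/-- The adjoint of `x_j ∂_i` is `x_i ∂_j`, so the adjoint of `leibniz A` is `leibniz Aᵀ = -leibniz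
A`. -/
theorem fischer_leibniz {n : ℕ} (A : SO n) (φ ψ : MvPolynomial (Fin n) ℝ) :
    fischer n (leibniz (A : Matrix (Fin n) (Fin n) ℝ) φ) ψ =
      - fischer n φ (leibniz (A : Matrix (Fin n) (Fin n) ℝ) ψ) := by
  obtain ⟨A, hA⟩ := A
  rw [LieAlgebra.Orthogonal.mem_so] at hA
  simp only [leibniz_apply, map_sum, LinearMap.sum_apply, map_smul, LinearMap.smul_apply,
    fischer_X_mul, fischer_mul_X]
  rw [Finset.sum_comm, ← Finset.sum_neg_distrib]
  refine Finset.sum_congr rfl fun i _ => ?_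
  rw [← Finset.sum_neg_distrib]
  refine Finset.sum_congr rfl fun j _ => ?_
  have : A i j = - A j i := by simpa using congrFun (congrFun hA j) i
  rw [this, smul_eq_mul, smul_eq_mul, neg_mul]

/-! ### Gaussian moments and integration by parts. -/

theorem integrable_pow_gaussianReal (k : ℕ) :
    Integrable (fun x : ℝ => x ^ k) (gaussianReal 0 1) := by
  have h := (memLp_id_gaussianReal (μ := 0) (v := 1) (k : NNReal)).integrable_norm_pow'
  refine (integrable_norm_iff (by fun_prop)).mp ?_
  simpa using h

/-- Integration by parts, using that the density satisfies `g' = -x g`. At `k = 0` the truncated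
exponent `k - 1` is harmless because of the factor `k`. -/
theorem integral_pow_succ_gaussianReal (k : ℕ) :
    ∫ x, x ^ (k + 1) ∂(gaussianReal 0 1) = k * ∫ x, x ^ (k - 1) ∂(gaussianReal 0 1) := by
  have hint : ∀ j : ℕ, Integrable (fun x : ℝ => x ^ j * gaussianPDFReal 0 1 x) := by
    intro j
    have h := integrable_pow_gaussianReal j
    rw [gaussianReal_of_var_ne_zero 0 one_ne_zero, gaussianPDF_def,
      integrable_withDensity_iff_integrable_smul₀' (by fun_prop) (by simp)] at h
    refine h.congr (Filter.Eventually.of_forall fun x => ?_)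
    simp [ENNReal.toReal_ofReal (gaussianPDFReal_nonneg 0 1 x), mul_comm]
  have hderiv : ∀ x : ℝ, HasDerivAt (gaussianPDFReal 0 1) (-(x * gaussianPDFReal 0 1 x)) x := by
    intro x
    have hpdf : gaussianPDFReal 0 1 = fun y => (√(2 * Real.pi))⁻¹ * Real.exp (-y ^ 2 / 2) := by
      ext y
      simp [gaussianPDFReal]
    have h1 : HasDerivAt (fun y : ℝ => -y ^ 2 / 2) (-x) x := by
      refine ((hasDerivAt_pow 2 x).neg.div_const 2).congr_deriv ?_
      simp
      ring
    rw [hpdf]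
    refine (h1.exp.const_mul ((√(2 * Real.pi))⁻¹)).congr_deriv ?_
    ring
  have hparts := integral_mul_deriv_eq_deriv_mul_of_integrable
    (u := fun x : ℝ => x ^ k) (u' := fun x => k * x ^ (k - 1)) (v := gaussianPDFReal 0 1)
    (v' := fun x => -(x * gaussianPDFReal 0 1 x))
    (fun x _ => hasDerivAt_pow k x) (fun x _ => hderiv x)
    (by
      refine (hint (k + 1)).neg.congr (Filter.Eventually.of_forall fun x => ?_)
      simp only [Pi.neg_apply, Pi.mul_apply]
      ring)
    (by
      refine ((hint (k - 1)).const_mul (k : ℝ)).congr (Filter.Eventually.of_forall fun x => ?_)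
      simp only [Pi.mul_apply]
      ring)
    (hint k)
  rw [integral_gaussianReal_eq_integral_smul one_ne_zero,
    integral_gaussianReal_eq_integral_smul one_ne_zero, ← integral_const_mul]
  have e1 : ∫ x : ℝ, x ^ k * -(x * gaussianPDFReal 0 1 x)
      = - ∫ x : ℝ, gaussianPDFReal 0 1 x • x ^ (k + 1) := by
    rw [← integral_neg]
    congr 1 with x
    simp only [smul_eq_mul]
    ring
  rw [e1, neg_inj] at hparts
  rw [hparts]
  congr 1 with x
  simp only [smul_eq_mul]
  ring

/-- The standard Gaussian measure on `ℝⁿ`. -/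
def stdGaussianPi (n : ℕ) : Measure (Fin n → ℝ) := Measure.pi fun _ => gaussianReal 0 1

theorem integrable_eval_monomial {n : ℕ} (m : Fin n →₀ ℕ) (c : ℝ) :
    Integrable (fun x => eval x (monomial m c)) (stdGaussianPi n) := by
  have h := Integrable.fintype_prod (f := fun i (t : ℝ) => t ^ m i)
    (μ := fun _ : Fin n => gaussianReal 0 1) fun i => integrable_pow_gaussianReal (m i)
  refine (h.const_mul c).congr (Filter.Eventually.of_forall fun x => ?_)
  simp [eval_monomial, Finsupp.prod_fintype]

theorem integrable_eval {n : ℕ} (f : MvPolynomial (Fin n) ℝ) :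
    Integrable (fun x => eval x f) (stdGaussianPi n) := by
  induction f using MvPolynomial.induction_on' with
  | monomial m c => exact integrable_eval_monomial m c
  | add p q hp hq =>
    simp only [map_add]
    exact hp.add hq

/-- The expectation of a polynomial under the standard Gaussian measure. -/
def gaussianMean (n : ℕ) : MvPolynomial (Fin n) ℝ →ₗ[ℝ] ℝ where
  toFun f := ∫ x, eval x f ∂(stdGaussianPi n)
  map_add' f g := by
    simp only [map_add]
    exact integral_add (integrable_eval f) (integrable_eval g)
  map_smul' c f := by
    simp only [smul_eval, RingHom.id_apply, smul_eq_mul]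
    exact integral_const_mul c _

theorem gaussianMean_nonneg {n : ℕ} {f : MvPolynomial (Fin n) ℝ} (hf : ∀ x, 0 ≤ eval x f) :
    0 ≤ gaussianMean n f :=
  integral_nonneg hf

theorem gaussianMean_monomial {n : ℕ} (m : Fin n →₀ ℕ) (c : ℝ) :
    gaussianMean n (monomial m c) = c * ∏ i, ∫ x, x ^ m i ∂(gaussianReal 0 1) := by
  have h := integral_fintype_prod_eq_prod (μ := fun _ : Fin n => gaussianReal 0 1)
    (f := fun i (t : ℝ) => t ^ m i)
  rw [← h, ← integral_const_mul]
  simp [gaussianMean, stdGaussianPi, eval_monomial, Finsupp.prod_fintype]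

/-- Stein's identity. On monomials the integral factors over coordinates and only the `i`-th factor
changes, by the one-dimensional recursion. -/
theorem gaussianMean_X_mul {n : ℕ} (i : Fin n) (f : MvPolynomial (Fin n) ℝ) :
    gaussianMean n (X i * f) = gaussianMean n (pderiv i f) := by
  induction f using MvPolynomial.induction_on' with
  | add p q hp hq => simp [mul_add, hp, hq]
  | monomial m c =>
    have hX : X i * monomial m c = monomial (m + Finsupp.single i 1) c := by
      rw [X, monomial_mul, one_mul, add_comm]
    rw [hX, pderiv_monomial, gaussianMean_monomial, gaussianMean_monomial,
      ← Finset.mul_prod_erase _ _ (Finset.mem_univ i)]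
    conv_rhs => rw [← Finset.mul_prod_erase _ _ (Finset.mem_univ i)]
    have he : ∏ j ∈ Finset.univ.erase i,
          ∫ x, x ^ ((m + Finsupp.single i 1 : Fin n →₀ ℕ) j) ∂(gaussianReal 0 1)
        = ∏ j ∈ Finset.univ.erase i,
          ∫ x, x ^ ((m - Finsupp.single i 1 : Fin n →₀ ℕ) j) ∂(gaussianReal 0 1) :=
      Finset.prod_congr rfl fun j hj => by
        simp [(Finset.ne_of_mem_erase hj).symm]
    rw [he, Finsupp.add_apply, Finsupp.tsub_apply, Finsupp.single_eq_same,
      integral_pow_succ_gaussianReal]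
    ring

/-! ### Fischer product as Gaussian `L²` product on harmonic polynomials. -/

/-- Euler's identity followed by Stein's: `q E[h] = E[∑ x_k ∂_k h] = E[Δh] = 0`. -/
theorem gaussianMean_eq_zero_of_harmonic {n q : ℕ} {h : MvPolynomial (Fin n) ℝ}
    (hh : h ∈ Sym0 n q) (hq : 0 < q) : gaussianMean n h = 0 := by
  have hom : h.IsHomogeneous q := hh.1
  have hlap : ∑ k, pderiv k (pderiv k h) = 0 := by
    simpa [laplacian, partialD] using hh.2
  have e := congrArg (gaussianMean n) hom.sum_X_mul_pderiv
  rw [map_sum] at e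
  simp only [gaussianMean_X_mul] at e
  rw [← map_sum, hlap, map_zero, map_nsmul, nsmul_eq_mul] at e
  have hq' : (q : ℝ) ≠ 0 := by positivity
  exact (mul_eq_zero.mp e.symm).resolve_left hq'

theorem pderiv_mem_Sym0 {n q : ℕ} {h : MvPolynomial (Fin n) ℝ} (hh : h ∈ Sym0 n q)
    (i : Fin n) : pderiv i h ∈ Sym0 n (q - 1) := by
  refine ⟨(show h.IsHomogeneous q from hh.1).pderiv, ?_⟩
  have hlap : ∑ k, pderiv k (pderiv k h) = 0 := by
    simpa [laplacian, partialD] using hh.2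
  have : laplacian n (pderiv i h) = ∑ k, pderiv k (pderiv k (pderiv i h)) := by
    simp [laplacian, partialD]
  change laplacian n (pderiv i h) = 0
  rw [this]
  simp only [partialD_comm _ i]
  rw [← map_sum, hlap, map_zero]

/-- The Gaussian `L²` pairing of a harmonic polynomial with a polynomial of no larger degree is
their Fischer product. -/
theorem gaussianMean_mul_monomial {n q : ℕ} {h : MvPolynomial (Fin n) ℝ} (hh : h ∈ Sym0 n q)
    (m : Fin n →₀ ℕ) (c : ℝ) (hm : m.degree ≤ q) :
    gaussianMean n (monomial m c * h) = fischer n (monomial m c) h := by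
  induction hd : m.degree using Nat.strong_induction_on generalizing m c q h with
  | _ d ih =>
  have hom : h.IsHomogeneous q := hh.1
  by_cases h0 : m = 0
  · subst h0
    have hC : monomial (0 : Fin n →₀ ℕ) c * h = c • h := by
      rw [← C_apply, ← smul_eq_C_mul]
    rw [hC, fischer_monomial, map_smul, smul_eq_mul]
    rcases Nat.eq_zero_or_pos q with rfl | hq
    · have hc : h.totalDegree = 0 := Nat.le_zero.mp hom.totalDegree_le
      rw [totalDegree_eq_zero_iff_eq_C] at hc
      have h1 : gaussianMean n h = coeff 0 h := by
        conv_lhs => rw [hc]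
        rw [C_apply, gaussianMean_monomial]
        simp
      simp [h1]
    · rw [gaussianMean_eq_zero_of_harmonic hh hq, hom.coeff_eq_zero (by simpa using hq.ne)]
      simp
  · obtain ⟨i, hi⟩ := Finsupp.ne_iff.mp h0
    obtain ⟨m', rfl⟩ : ∃ m', m = m' + Finsupp.single i 1 := by
      refine ⟨m - Finsupp.single i 1, (tsub_add_cancel_of_le ?_).symm⟩
      rw [Finsupp.single_le_iff]
      exact Nat.one_le_iff_ne_zero.mpr hi
    have hdeg : m'.degree + 1 = d := by
      rw [← hd, map_add, Finsupp.degree_single]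
    have hX : monomial (m' + Finsupp.single i 1) c = X i * monomial m' c := by
      rw [X, monomial_mul, one_mul, add_comm]
    have hsub : (m' - Finsupp.single i 1).degree < d :=
      lt_of_le_of_lt (Finsupp.degree_mono tsub_le_self) (by omega)
    -- Stein's identity moves `∂_i` onto `x^m' h`. The term with `∂_i x^m'` pairs a monomial of
    -- degree below `q` with `h`, so its Fischer product vanishes; the term with `∂_i h` is the
    -- adjointness relation. The first term is why the induction assumes degree `≤ q` rather than `=
    -- q`.
    rw [hX, mul_assoc, gaussianMean_X_mul, pderiv_mul, map_add, fischer_X_mul, pderiv_monomial,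
      ih _ hsub hh _ _ (by omega) rfl, ih m'.degree (by omega) (pderiv_mem_Sym0 hh i) _ _
        (by omega) rfl, fischer_monomial, hom.coeff_eq_zero (by omega)]
    simp

theorem gaussianMean_mul {n p : ℕ} {φ ψ : MvPolynomial (Fin n) ℝ} (hφ : φ.IsHomogeneous p)
    (hψ : ψ ∈ Sym0 n p) : gaussianMean n (φ * ψ) = fischer n φ ψ := by
  rw [φ.as_sum, Finset.sum_mul, map_sum, map_sum, LinearMap.sum_apply]
  refine Finset.sum_congr rfl fun m hm => gaussianMean_mul_monomial hψ m _ ?_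
  exact (hφ.degree_eq_sum_deg_support hm).symm.le

/-! ### Decomposable bivectors and sectional curvature. -/

theorem inner_wedge_wedge {n : ℕ} (x y z w : Euc n) :
    inner ℝ (wedge x y) (wedge z w) = inner ℝ x z * inner ℝ y w - inner ℝ x w * inner ℝ y z := by
  rw [wedge, wedge, exteriorPower.inner_ιMulti_ιMulti, Matrix.det_fin_two]
  simp
  ring

theorem inner_smul_left_wedge {n : ℕ} (c : ℝ) (σ τ : Wedge2 n) :
    inner ℝ (c • σ) τ = c * inner ℝ σ τ :=
  real_inner_smul_left σ τ c

theorem inner_smul_right_wedge {n : ℕ} (c : ℝ) (σ τ : Wedge2 n) :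
    inner ℝ σ (c • τ) = c * inner ℝ σ τ :=
  real_inner_smul_right σ τ c

theorem wedge_self {n : ℕ} (x : Euc n) : wedge x x = 0 :=
  (exteriorPower.ιMulti ℝ 2).map_eq_zero_of_eq ![x, x] (i := 0) (j := 1) rfl (by decide)

theorem wedge_eq_update_left {n : ℕ} (x y : Euc n) :
    wedge x y = exteriorPower.ιMulti ℝ 2 (Function.update ![0, y] 0 x) := by
  rw [wedge]
  congr 1
  ext i : 1
  fin_cases i <;> simp

theorem wedge_eq_update_right {n : ℕ} (x y : Euc n) :
    wedge x y = exteriorPower.ιMulti ℝ 2 (Function.update ![x, 0] 1 y) := by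
  rw [wedge]
  congr 1
  ext i : 1
  fin_cases i <;> simp

theorem wedge_add_smul {n : ℕ} (x y : Euc n) (a : ℝ) : wedge x (y + a • x) = wedge x y := by
  rw [wedge_eq_update_right, AlternatingMap.map_update_add, AlternatingMap.map_update_smul,
    ← wedge_eq_update_right, ← wedge_eq_update_right, wedge_self, smul_zero, add_zero]

theorem wedge_smul_smul {n : ℕ} (x y : Euc n) (a b : ℝ) :
    wedge (a • x) (b • y) = (a * b) • wedge x y := by
  rw [wedge_eq_update_right, AlternatingMap.map_update_smul, ← wedge_eq_update_right,
    wedge_eq_update_left, AlternatingMap.map_update_smul, ← wedge_eq_update_left, smul_smul,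
    mul_comm]

theorem wedgeToSO_wedge {n : ℕ} (x y : Euc n) :
    ((wedgeToSO n (wedge x y) : SO n) : Matrix (Fin n) (Fin n) ℝ)
      = Matrix.of fun i j => x i * y j - y i * x j := by
  simp [wedgeToSO, wedge, skewOfPair]

/-- Reduces identities about basis bivectors to decomposable ones, where both the matrix and the
Gram determinant are explicit. -/
theorem exists_wedgeBasis_eq {n : ℕ} (a : Set.powersetCard (Fin n) 2) :
    ∃ x y : Euc n, wedgeBasis n a = wedge x y := by
  refine ⟨EuclideanSpace.basisFun (Fin n) ℝ (Set.powersetCard.ofFinEmbEquiv.symm a 0),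
    EuclideanSpace.basisFun (Fin n) ℝ (Set.powersetCard.ofFinEmbEquiv.symm a 1), ?_⟩
  have h : wedgeBasis n a = (wedgeBasis n).toBasis a := by simp
  rw [h, wedgeBasis, OrthonormalBasis.toBasis_exteriorPower, exteriorPower.coe_basis, wedge]
  unfold exteriorPower.ιMulti_family
  congr 1
  ext i : 1
  fin_cases i <;> simp

theorem sum_inner_wedgeBasis {n : ℕ} (R : Module.End ℝ (Wedge2 n)) (σ τ : Wedge2 n) :
    ∑ a, ∑ b, inner ℝ (R (wedgeBasis n a)) (wedgeBasis n b) *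
      (inner ℝ (wedgeBasis n a) σ * inner ℝ (wedgeBasis n b) τ) = inner ℝ (R σ) τ := by
  conv_rhs => rw [← (wedgeBasis n).sum_repr' σ, ← (wedgeBasis n).sum_repr' τ]
  simp only [map_sum, map_smul, sum_inner, inner_sum, inner_smul_left_wedge, inner_smul_right_wedge]
  rw [Finset.sum_comm]
  refine Finset.sum_congr rfl fun a _ => Finset.sum_congr rfl fun b _ => ?_
  ring

/-- Nonnegative sectional curvature is nonnegativity on all decomposable elements. -/
theorem SecGE.inner_wedge_nonneg {n : ℕ} {R : Module.End ℝ (Wedge2 n)} (h : SecGE R 0)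
    (x y : Euc n) : 0 ≤ inner ℝ (R (wedge x y)) (wedge x y) := by
  by_cases hx : x = 0
  · have : wedge x y = 0 := by simpa [hx] using wedge_smul_smul (0 : Euc n) y 0 1
    simp [this]
  set e : Euc n := ‖x‖⁻¹ • x with he
  have hxn : ‖x‖ ≠ 0 := norm_ne_zero_iff.mpr hx
  have hee : ‖e‖ = 1 := norm_smul_inv_norm (𝕜 := ℝ) hx
  have hxe : x = ‖x‖ • e := by rw [he, smul_smul, mul_inv_cancel₀ hxn, one_smul]
  -- Gram–Schmidt: removing the `e`-component of `y` does not change the wedge, so `x ∧ y` is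
  -- `‖x‖‖z‖` times the wedge of an orthonormal pair.
  set z : Euc n := y + (-(inner ℝ e y : ℝ)) • e with hz
  have hez : inner ℝ e z = 0 := by
    rw [hz, inner_add_right, inner_smul_right, real_inner_self_eq_norm_sq, hee]
    ring
  have hwz : wedge x y = ‖x‖ • wedge e z := by
    have h1 := wedge_smul_smul e y ‖x‖ 1
    rw [← hxe, one_smul, mul_one] at h1
    rw [h1, hz, wedge_add_smul]
  by_cases hz0 : z = 0
  · have : wedge e z = 0 := by simpa [hz0] using wedge_smul_smul e (0 : Euc n) 1 0
    simp [hwz, this]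
  have hzn : ‖z‖ ≠ 0 := norm_ne_zero_iff.mpr hz0
  have hon : Orthonormal ℝ ![e, ‖z‖⁻¹ • z] := by
    have hnn : ‖‖z‖⁻¹ • z‖ = 1 := norm_smul_inv_norm (𝕜 := ℝ) hz0
    constructor
    · intro i
      fin_cases i
      · exact hee
      · exact hnn
    · intro i j hij
      fin_cases i <;> fin_cases j
      · exact absurd rfl hij
      · simp [inner_smul_right, hez]
      · simp [inner_smul_left, real_inner_comm, hez]
      · exact absurd rfl hij
  have hw : wedge x y = (‖x‖ * ‖z‖) • wedge e (‖z‖⁻¹ • z) := by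
    have h1 := wedge_smul_smul e z 1 ‖z‖⁻¹
    rw [one_smul, one_mul] at h1
    rw [hwz, h1, smul_smul, mul_assoc, mul_inv_cancel₀ hzn, mul_one]
  rw [hw, map_smul, inner_smul_left_wedge, inner_smul_right_wedge, ← mul_assoc]
  exact mul_nonneg (mul_self_nonneg _) (h _ _ hon)

theorem secGE_sub_smul_iff {n : ℕ} (R : Module.End ℝ (Wedge2 n)) (k : ℝ) :
    SecGE (R - k • LinearMap.id) 0 ↔ SecGE R k := by
  refine forall₂_congr fun x y => forall_congr' fun h => ?_
  have h0 : inner ℝ x x = (1 : ℝ) := by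
    rw [real_inner_self_eq_norm_sq, show ‖x‖ = 1 from h.1 0, one_pow]
  have h1 : inner ℝ y y = (1 : ℝ) := by
    rw [real_inner_self_eq_norm_sq, show ‖y‖ = 1 from h.1 1, one_pow]
  have h2 : inner ℝ x y = (0 : ℝ) := h.2 (i := 0) (j := 1) (by decide)
  have hw : inner ℝ (wedge x y) (wedge x y) = (1 : ℝ) := by
    rw [inner_wedge_wedge, h0, h1, h2]
    ring
  rw [LinearMap.sub_apply, inner_sub_left, LinearMap.smul_apply, LinearMap.id_apply,
    inner_smul_left_wedge, hw]
  simp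

/-! ### The curvature term as a Gaussian integral. -/

/-- The gradient of a polynomial at a point. -/
def gradientAt {n : ℕ} (φ : MvPolynomial (Fin n) ℝ) (w : Fin n → ℝ) : Euc n :=
  WithLp.toLp 2 fun i => eval w (pderiv i φ)

/-- For `X = x ∧ y` both sides equal `⟨x, w⟩⟨y, ∇φ(w)⟩ - ⟨y, w⟩⟨x, ∇φ(w)⟩`. -/
theorem eval_leibniz_wedgeToSO {n : ℕ} (a : Set.powersetCard (Fin n) 2)
    (φ : MvPolynomial (Fin n) ℝ) (w : Fin n → ℝ) :
    eval w (leibniz (wedgeToSO n (wedgeBasis n a) : Matrix (Fin n) (Fin n) ℝ) φ)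
      = inner ℝ (wedgeBasis n a) (wedge (WithLp.toLp 2 w) (gradientAt φ w)) := by
  obtain ⟨x, y, h⟩ := exists_wedgeBasis_eq a
  rw [h, wedgeToSO_wedge, inner_wedge_wedge, mul_comm (inner ℝ x (gradientAt φ w)), leibniz_apply]
  simp only [map_sum, smul_eval, map_mul, eval_X, Matrix.of_apply, PiLp.inner_apply,
    gradientAt, RCLike.inner_apply, conj_trivial]
  rw [Finset.sum_comm, Finset.sum_mul_sum, Finset.sum_mul_sum, ← Finset.sum_sub_distrib]
  refine Finset.sum_congr rfl fun i _ => ?_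
  rw [← Finset.sum_sub_distrib]
  refine Finset.sum_congr rfl fun j _ => ?_
  ring

/-- `L_a = dρ(X_a)` acting on all polynomials. -/
def leibnizBasis {n : ℕ} (a : Set.powersetCard (Fin n) 2) :
    Module.End ℝ (MvPolynomial (Fin n) ℝ) :=
  leibniz (wedgeToSO n (wedgeBasis n a) : Matrix (Fin n) (Fin n) ℝ)

theorem curvatureTermSym0_coe {n p : ℕ} (R : Module.End ℝ (Wedge2 n)) (φ : Sym0 n p) :
    (curvatureTermSym0 R p φ : MvPolynomial (Fin n) ℝ) =
      -∑ a, ∑ b, inner ℝ (R (wedgeBasis n a)) (wedgeBasis n b) •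
        leibnizBasis a (leibnizBasis b φ.1) := by
  simp only [curvatureTermSym0, curvatureTerm, LinearMap.neg_apply, LinearMap.sum_apply,
    LinearMap.smul_apply, Module.End.mul_apply, Submodule.coe_neg, Submodule.coe_sum,
    Submodule.coe_smul]
  rfl

/-- Skewness of `L_a` moves it to the other side and absorbs the minus sign of `𝒦`. -/
theorem symInner_curvatureTermSym0 {n p : ℕ} (R : Module.End ℝ (Wedge2 n)) (φ ψ : Sym0 n p) :
    symInner (curvatureTermSym0 R p φ).1 ψ.1 =
      ∑ a, ∑ b, inner ℝ (R (wedgeBasis n a)) (wedgeBasis n b) *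
        fischer n (leibnizBasis b φ.1) (leibnizBasis a ψ.1) := by
  rw [symInner_eq_fischer, curvatureTermSym0_coe]
  simp only [map_neg, LinearMap.neg_apply, map_sum, LinearMap.sum_apply, map_smul,
    LinearMap.smul_apply, smul_eq_mul, ← Finset.sum_neg_distrib]
  refine Finset.sum_congr rfl fun a _ => Finset.sum_congr rfl fun b _ => ?_
  rw [leibnizBasis, fischer_leibniz]
  simp [leibnizBasis]

theorem symInner_curvatureTermSym0_comm {n p : ℕ} {R : Module.End ℝ (Wedge2 n)}
    (hR : R.IsSymmetric) (φ ψ : Sym0 n p) :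
    symInner (curvatureTermSym0 R p φ).1 ψ.1 = symInner φ.1 (curvatureTermSym0 R p ψ).1 := by
  have hc : symInner φ.1 (curvatureTermSym0 R p ψ).1 = symInner (curvatureTermSym0 R p ψ).1 φ.1 := by
    rw [symInner_eq_fischer, symInner_eq_fischer, fischer_comm]
  rw [hc, symInner_curvatureTermSym0, symInner_curvatureTermSym0, Finset.sum_comm]
  refine Finset.sum_congr rfl fun a _ => Finset.sum_congr rfl fun b _ => ?_
  rw [hR, real_inner_comm, fischer_comm]

theorem symInner_curvatureTermSym0_self {n p : ℕ} (R : Module.End ℝ (Wedge2 n)) (φ : Sym0 n p) :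
    symInner (curvatureTermSym0 R p φ).1 φ.1 =
      ∑ a, ∑ b, inner ℝ (R (wedgeBasis n a)) (wedgeBasis n b) *
        fischer n (leibnizBasis a φ.1) (leibnizBasis b φ.1) := by
  rw [symInner_curvatureTermSym0]
  simp only [fischer_comm]

/-- `SO n` preserves harmonicity, so each Fischer product of `L_a φ` and `L_b φ` is a Gaussian mean,
and the combined integrand at `w` is `R` evaluated on `w ∧ ∇φ(w)`. -/
theorem SecGE.symInner_curvatureTermSym0_nonneg {n p : ℕ} {R : Module.End ℝ (Wedge2 n)}
    (h : SecGE R 0) (φ : Sym0 n p) : 0 ≤ symInner (curvatureTermSym0 R p φ).1 φ.1 := by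
  have hL : ∀ a, leibnizBasis a φ.1 ∈ Sym0 n p := fun a => leibniz_mem_Sym0 _ φ.2
  have e : symInner (curvatureTermSym0 R p φ).1 φ.1 = gaussianMean n
      (∑ a, ∑ b, inner ℝ (R (wedgeBasis n a)) (wedgeBasis n b) •
        (leibnizBasis a φ.1 * leibnizBasis b φ.1)) := by
    rw [symInner_curvatureTermSym0_self]
    simp only [map_sum, map_smul, smul_eq_mul]
    refine Finset.sum_congr rfl fun a _ => Finset.sum_congr rfl fun b _ => ?_
    rw [gaussianMean_mul (hL a).1 (hL b)]
  rw [e]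
  refine gaussianMean_nonneg fun w => ?_
  simp only [map_sum, smul_eval, map_mul, leibnizBasis, eval_leibniz_wedgeToSO]
  rw [sum_inner_wedgeBasis]
  exact h.inner_wedge_nonneg _ _

/-! ### Test polynomials: powers of an isotropic linear form. -/

/-- The linear form `⟨w, ·⟩` as a polynomial. -/
def linForm {n : ℕ} (w : Euc n) : MvPolynomial (Fin n) ℝ := ∑ i, C (w i) * X i

/-- The directional derivative along `w`. -/
def dirDeriv {n : ℕ} (w : Euc n) (φ : MvPolynomial (Fin n) ℝ) : MvPolynomial (Fin n) ℝ :=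
  ∑ i, C (w i) * pderiv i φ

theorem pderiv_linForm {n : ℕ} (w : Euc n) (i : Fin n) : pderiv i (linForm w) = C (w i) := by
  classical
  simp [linForm, pderiv_X, Pi.single_apply]

theorem euc_inner_eq_sum {n : ℕ} (a b : Euc n) : inner ℝ a b = ∑ i, a i * b i := by
  simp [PiLp.inner_apply, mul_comm]

theorem dirDeriv_linForm_mul {n : ℕ} (a b : Euc n) (φ : MvPolynomial (Fin n) ℝ) :
    dirDeriv a (linForm b * φ) = C (inner ℝ a b) * φ + linForm b * dirDeriv a φ := by
  rw [dirDeriv, dirDeriv, euc_inner_eq_sum, map_sum, Finset.sum_mul, Finset.mul_sum,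
    ← Finset.sum_add_distrib]
  refine Finset.sum_congr rfl fun i _ => ?_
  rw [pderiv_mul, pderiv_linForm, map_mul]
  ring

theorem fischer_C_mul {n : ℕ} (c : ℝ) (φ ψ : MvPolynomial (Fin n) ℝ) :
    fischer n (C c * φ) ψ = c * fischer n φ ψ := by
  rw [← smul_eq_C_mul, map_smul, LinearMap.smul_apply, smul_eq_mul]

theorem fischer_mul_C {n : ℕ} (c : ℝ) (φ ψ : MvPolynomial (Fin n) ℝ) :
    fischer n φ (C c * ψ) = c * fischer n φ ψ := by
  rw [← smul_eq_C_mul, map_smul, smul_eq_mul]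

theorem fischer_linForm_mul {n : ℕ} (a : Euc n) (φ ψ : MvPolynomial (Fin n) ℝ) :
    fischer n (linForm a * φ) ψ = fischer n φ (dirDeriv a ψ) := by
  simp only [linForm, dirDeriv, Finset.sum_mul, map_sum, LinearMap.sum_apply, mul_assoc,
    fischer_C_mul, fischer_mul_C, fischer_X_mul]

theorem fischer_mul_linForm {n : ℕ} (a : Euc n) (φ ψ : MvPolynomial (Fin n) ℝ) :
    fischer n φ (linForm a * ψ) = fischer n (dirDeriv a φ) ψ := by
  rw [fischer_comm, fischer_linForm_mul, fischer_comm]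

/-- Adjointness combined with the commutation relation `[∂_a, ⟨b, ·⟩] = ⟨a, b⟩`. -/
theorem fischer_linForm_mul_linForm_mul {n : ℕ} (a b : Euc n) (φ ψ : MvPolynomial (Fin n) ℝ) :
    fischer n (linForm a * φ) (linForm b * ψ) =
      inner ℝ a b * fischer n φ ψ + fischer n (dirDeriv b φ) (dirDeriv a ψ) := by
  rw [fischer_linForm_mul, dirDeriv_linForm_mul, map_add, fischer_mul_C, fischer_mul_linForm]

/-- The real and imaginary parts of `(⟨u, ·⟩ + i ⟨v, ·⟩)^p`. -/
def planePow {n : ℕ} (u v : Euc n) : ℕ → MvPolynomial (Fin n) ℝ × MvPolynomial (Fin n) ℝ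
  | 0 => (1, 0)
  | p + 1 => (linForm u * (planePow u v p).1 - linForm v * (planePow u v p).2,
      linForm u * (planePow u v p).2 + linForm v * (planePow u v p).1)

/-- Real and imaginary parts of `∂_i ℓ^(p+1) = (p+1)(u_i + i v_i) ℓ^p`. -/
theorem pderiv_planePow {n : ℕ} (u v : Euc n) (i : Fin n) (p : ℕ) :
    pderiv i (planePow u v (p + 1)).1 =
        C ((p : ℝ) + 1) * (C (u i) * (planePow u v p).1 - C (v i) * (planePow u v p).2) ∧
      pderiv i (planePow u v (p + 1)).2 =
        C ((p : ℝ) + 1) * (C (u i) * (planePow u v p).2 + C (v i) * (planePow u v p).1) := by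
  induction p with
  | zero => simp [planePow, pderiv_linForm]
  | succ p ih =>
    rw [planePow]
    simp only [map_add, map_sub, pderiv_mul, pderiv_linForm, ih.1, ih.2]
    simp only [planePow, Nat.cast_add, Nat.cast_one, map_add, map_one]
    constructor <;> ring

theorem dirDeriv_planePow_fst {n : ℕ} (u v a : Euc n) (p : ℕ) :
    dirDeriv a (planePow u v (p + 1)).1 = ((p : ℝ) + 1) •
      ((inner ℝ a u : ℝ) • (planePow u v p).1 - (inner ℝ a v : ℝ) • (planePow u v p).2) := by
  simp only [smul_eq_C_mul, dirDeriv, (pderiv_planePow u v _ p).1, euc_inner_eq_sum, map_sum, map_mul,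
    Finset.sum_mul, Finset.mul_sum, ← Finset.sum_sub_distrib]
  exact Finset.sum_congr rfl fun i _ => by ring

theorem dirDeriv_planePow_snd {n : ℕ} (u v a : Euc n) (p : ℕ) :
    dirDeriv a (planePow u v (p + 1)).2 = ((p : ℝ) + 1) •
      ((inner ℝ a u : ℝ) • (planePow u v p).2 + (inner ℝ a v : ℝ) • (planePow u v p).1) := by
  simp only [smul_eq_C_mul, dirDeriv, (pderiv_planePow u v _ p).2, euc_inner_eq_sum, map_sum, map_mul,
    Finset.sum_mul, Finset.mul_sum, ← Finset.sum_add_distrib]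
  exact Finset.sum_congr rfl fun i _ => by ring

theorem isHomogeneous_linForm {n : ℕ} (w : Euc n) : (linForm w).IsHomogeneous 1 :=
  IsHomogeneous.sum _ _ _ fun i _ => isHomogeneous_C_mul_X _ i

theorem isHomogeneous_planePow {n : ℕ} (u v : Euc n) (p : ℕ) :
    (planePow u v p).1.IsHomogeneous p ∧ (planePow u v p).2.IsHomogeneous p := by
  induction p with
  | zero => exact ⟨isHomogeneous_one _ _, isHomogeneous_zero _ _ _⟩
  | succ p ih =>
    rw [planePow, add_comm p 1]
    have hu := isHomogeneous_linForm u
    have hv := isHomogeneous_linForm v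
    exact ⟨(hu.mul ih.1).sub (hv.mul ih.2), (hu.mul ih.2).add (hv.mul ih.1)⟩

theorem sum_C_mul_C {n : ℕ} (a b : Euc n) :
    ∑ i, (C (a i) * C (b i) : MvPolynomial (Fin n) ℝ) = C (inner ℝ a b) := by
  simp [euc_inner_eq_sum]

/-- The Laplacian of `ℓ^(p+2)` carries the factor `|u|² - |v|² + 2i⟨u, v⟩`, which vanishes. -/
theorem planePow_mem_Sym0 {n : ℕ} {u v : Euc n} (hu : inner ℝ u u = (1 : ℝ))
    (hv : inner ℝ v v = (1 : ℝ)) (huv : inner ℝ u v = (0 : ℝ)) (p : ℕ) :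
    (planePow u v (p + 2)).1 ∈ Sym0 n (p + 2) ∧ (planePow u v (p + 2)).2 ∈ Sym0 n (p + 2) := by
  have hom := isHomogeneous_planePow u v (p + 2)
  have hvu : inner ℝ v u = (0 : ℝ) := by rw [real_inner_comm, huv]
  have hlap : ∀ φ, laplacian n φ = ∑ k, pderiv k (pderiv k φ) := by simp [laplacian, partialD]
  have e : ∀ c d : MvPolynomial (Fin n) ℝ, ∀ r : ℝ,
      (∑ k : Fin n, (C (u k) * (C r * (C (u k) * c - C (v k) * d)) -
        C (v k) * (C r * (C (u k) * d + C (v k) * c)))) = 0 := by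
    intro c d r
    have : ∀ k : Fin n, (C (u k) * (C r * (C (u k) * c - C (v k) * d)) -
        C (v k) * (C r * (C (u k) * d + C (v k) * c))) =
        (C (u k) * C (u k)) * (C r * c) - (C (v k) * C (v k)) * (C r * c)
          - (C (u k) * C (v k)) * (2 * C r * d) := fun k => by ring
    simp only [this, Finset.sum_sub_distrib, ← Finset.sum_mul, sum_C_mul_C, hu, hv, huv]
    simp
  refine ⟨⟨hom.1, ?_⟩, ⟨hom.2, ?_⟩⟩
  · change laplacian n _ = 0
    simp only [hlap, (pderiv_planePow u v _ (p + 1)).1, pderiv_C_mul, map_sub,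
      (pderiv_planePow u v _ p).1, (pderiv_planePow u v _ p).2, ← Finset.mul_sum]
    rw [e, mul_zero]
  · change laplacian n _ = 0
    simp only [hlap, (pderiv_planePow u v _ (p + 1)).2, pderiv_C_mul, Derivation.map_add,
      (pderiv_planePow u v _ p).1, (pderiv_planePow u v _ p).2, ← Finset.mul_sum]
    have hs : ∀ r : ℝ, ∀ c d : MvPolynomial (Fin n) ℝ,
        ∑ k : Fin n, (C (u k) * (C r * (C (u k) * d + C (v k) * c)) +
          C (v k) * (C r * (C (u k) * c - C (v k) * d))) = 0 := by
      intro r c d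
      -- Multiplying `c + id` by `-i` turns the real-part identity into the imaginary one.
      rw [← e d (-c) r]
      exact Finset.sum_congr rfl fun k _ => by ring
    rw [hs, mul_zero]

/-- The squared Hermitian length of `(⟨u, ·⟩ + i ⟨v, ·⟩)^p`. -/
def planePowSq {n : ℕ} (u v : Euc n) (p : ℕ) : ℝ :=
  fischer n (planePow u v p).1 (planePow u v p).1 + fischer n (planePow u v p).2 (planePow u v p).2

/-- Peel one linear factor off by adjointness: `∂_u` and `∂_v` send `ℓ^(p+1)` to `(p+1)ℓ^p` and
`i(p+1)ℓ^p`. -/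
theorem fischer_planePow_succ {n : ℕ} {u v : Euc n} (hu : inner ℝ u u = (1 : ℝ))
    (hv : inner ℝ v v = (1 : ℝ)) (huv : inner ℝ u v = (0 : ℝ)) (p : ℕ) :
    fischer n (planePow u v (p + 1)).1 (planePow u v (p + 1)).1 = (p + 1) * planePowSq u v p ∧
    fischer n (planePow u v (p + 1)).2 (planePow u v (p + 1)).2 = (p + 1) * planePowSq u v p ∧
    fischer n (planePow u v (p + 1)).1 (planePow u v (p + 1)).2 = 0 := by
  have hvu : inner ℝ v u = (0 : ℝ) := by rw [real_inner_comm, huv]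
  have h1 : (planePow u v (p + 1)).1 =
    linForm u * (planePow u v p).1 - linForm v * (planePow u v p).2 := rfl
  have h2 : (planePow u v (p + 1)).2 =
    linForm u * (planePow u v p).2 + linForm v * (planePow u v p).1 := rfl
  refine ⟨?_, ?_, ?_⟩
  · conv_lhs => enter [1, 2]; rw [h1]
    simp only [map_sub, LinearMap.sub_apply, fischer_linForm_mul, dirDeriv_planePow_fst,
      map_smul, smul_eq_mul, zero_smul, one_smul, hu, hv, huv, hvu, planePowSq, map_zero]
    ring
  · conv_lhs => enter [1, 2]; rw [h2]
    simp only [map_add, LinearMap.add_apply, fischer_linForm_mul, dirDeriv_planePow_snd,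
      map_smul, smul_eq_mul, zero_smul, one_smul, hu, hv, huv, hvu, planePowSq, map_zero]
    ring
  · conv_lhs => enter [1, 2]; rw [h1]
    simp only [map_add, map_sub, LinearMap.sub_apply, fischer_linForm_mul, dirDeriv_planePow_snd,
      map_smul, smul_eq_mul, zero_smul, one_smul, hu, hv, huv, hvu, map_zero]
    rw [fischer_comm (planePow u v p).2]
    ring

theorem planePowSq_pos {n : ℕ} {u v : Euc n} (hu : inner ℝ u u = (1 : ℝ))
    (hv : inner ℝ v v = (1 : ℝ)) (huv : inner ℝ u v = (0 : ℝ)) (p : ℕ) :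
    0 < planePowSq u v p := by
  induction p with
  | zero =>
    have : fischer n 1 1 = 1 := by
      conv_lhs => enter [1]; rw [← C_1, C_apply]
      rw [fischer_monomial]
      simp
    simp [planePowSq, planePow, this]
  | succ p ih =>
    obtain ⟨h1, h2, -⟩ := fischer_planePow_succ hu hv huv p
    rw [planePowSq, h1, h2]
    positivity

/-- Models `a = Au`, `a' = Av`, `b = Bu`, `b' = Bv` with `A`, `B` skew; the pairs are the real and
imaginary parts of `(⟨a, ·⟩ + i⟨a', ·⟩)ℓ^(p+1)` and its analogue for `b`. Commutators yield `⟨a, b⟩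
+ ⟨a', b'⟩`; differentiating `ℓ^(p+1)` on both sides yields `αβ` with one more factor of order `p`.
-/
theorem fischer_rotated_planePow {n : ℕ} {u v : Euc n} (hu : inner ℝ u u = (1 : ℝ))
    (hv : inner ℝ v v = (1 : ℝ)) (huv : inner ℝ u v = (0 : ℝ)) (p : ℕ) {a a' b b' : Euc n}
    {α β : ℝ} (ha : inner ℝ a u = (0 : ℝ)) (ha' : inner ℝ a' v = (0 : ℝ))
    (hb : inner ℝ b u = (0 : ℝ)) (hb' : inner ℝ b' v = (0 : ℝ))
    (hα : inner ℝ a v = α) (hα' : inner ℝ a' u = -α)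
    (hβ : inner ℝ b v = β) (hβ' : inner ℝ b' u = -β) :
    fischer n (linForm a * (planePow u v (p + 1)).1 - linForm a' * (planePow u v (p + 1)).2)
        (linForm b * (planePow u v (p + 1)).1 - linForm b' * (planePow u v (p + 1)).2) +
      fischer n (linForm a * (planePow u v (p + 1)).2 + linForm a' * (planePow u v (p + 1)).1)
        (linForm b * (planePow u v (p + 1)).2 + linForm b' * (planePow u v (p + 1)).1) =
    2 * (p + 1) * planePowSq u v p *
      ((inner ℝ a b + inner ℝ a' b') + 2 * (p + 1) * (α * β)) := by
  obtain ⟨h1, h2, h3⟩ := fischer_planePow_succ hu hv huv p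
  have h4 := h3
  rw [fischer_comm] at h4
  simp only [map_add, map_sub, LinearMap.sub_apply, LinearMap.add_apply,
    fischer_linForm_mul_linForm_mul, dirDeriv_planePow_fst, dirDeriv_planePow_snd,
    map_smul, LinearMap.smul_apply, smul_eq_mul, zero_smul, neg_smul, map_neg,
    LinearMap.neg_apply, ha, ha', hb, hb', hα, hα', hβ, hβ', h1, h2, h3, h4,
    map_zero, LinearMap.zero_apply]
  rw [planePowSq]
  ring

/-- `leibniz A` is a derivation sending `⟨u, ·⟩` to `⟨Au, ·⟩`. -/
theorem leibniz_planePow {n : ℕ} (A : Matrix (Fin n) (Fin n) ℝ) (u v : Euc n) (p : ℕ) :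
    leibniz A (planePow u v (p + 1)).1 = C ((p : ℝ) + 1) *
      (linForm (WithLp.toLp 2 (A.mulVec u)) * (planePow u v p).1 -
        linForm (WithLp.toLp 2 (A.mulVec v)) * (planePow u v p).2) ∧
    leibniz A (planePow u v (p + 1)).2 = C ((p : ℝ) + 1) *
      (linForm (WithLp.toLp 2 (A.mulVec u)) * (planePow u v p).2 +
        linForm (WithLp.toLp 2 (A.mulVec v)) * (planePow u v p).1) := by
  have e : ∀ w : Euc n, linForm (WithLp.toLp 2 (A.mulVec w)) =
      ∑ i, ∑ j, C (A j i) * C (w i) * X j := by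
    intro w
    rw [Finset.sum_comm]
    simp [linForm, Matrix.mulVec, dotProduct, Finset.sum_mul]
  rw [leibniz_apply, leibniz_apply, e, e]
  simp only [(pderiv_planePow u v _ p).1, (pderiv_planePow u v _ p).2, smul_eq_C_mul,
    Finset.sum_mul, Finset.mul_sum, ← Finset.sum_sub_distrib, ← Finset.sum_add_distrib]
  constructor <;>
  exact Finset.sum_congr rfl fun i _ => Finset.sum_congr rfl fun j _ => by ring

theorem inner_mulVec_wedgeToSO {n : ℕ} (a : Set.powersetCard (Fin n) 2) (u v : Euc n) :
    inner ℝ (WithLp.toLp 2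
      ((wedgeToSO n (wedgeBasis n a) : Matrix (Fin n) (Fin n) ℝ).mulVec u) : Euc n) v
      = inner ℝ (wedgeBasis n a) (wedge v u) := by
  obtain ⟨x, y, h⟩ := exists_wedgeBasis_eq a
  rw [h, wedgeToSO_wedge, inner_wedge_wedge, mul_comm (inner ℝ x u)]
  simp only [euc_inner_eq_sum, Matrix.mulVec, dotProduct, Matrix.of_apply]
  rw [Finset.sum_mul_sum, Finset.sum_mul_sum, ← Finset.sum_sub_distrib]
  refine Finset.sum_congr rfl fun i _ => ?_
  rw [Finset.sum_mul, ← Finset.sum_sub_distrib]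
  refine Finset.sum_congr rfl fun j _ => ?_
  ring

theorem inner_wedgeBasis_wedge_swap {n : ℕ} (a : Set.powersetCard (Fin n) 2) (u v : Euc n) :
    inner ℝ (wedgeBasis n a) (wedge u v) = -inner ℝ (wedgeBasis n a) (wedge v u) := by
  obtain ⟨x, y, h⟩ := exists_wedgeBasis_eq a
  rw [h, inner_wedge_wedge, inner_wedge_wedge]
  ring

/-! ### Recovering sectional curvature as `p → ∞`. -/

theorem SecGE.of_symInner_nonneg {n : ℕ} {R : Module.End ℝ (Wedge2 n)}
    (h : ∀ p : ℕ, 2 ≤ p → ∀ φ : Sym0 n p, 0 ≤ symInner (curvatureTermSym0 R p φ).1 φ.1) :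
    SecGE R 0 := by
  -- The first vector is called `v` because `⟨X_a u, v⟩ = ⟨X_a, v ∧ u⟩`.
  intro v u ho
  have hv : inner ℝ v v = (1 : ℝ) := by
    rw [real_inner_self_eq_norm_sq, show ‖v‖ = 1 from ho.1 0, one_pow]
  have hu : inner ℝ u u = (1 : ℝ) := by
    rw [real_inner_self_eq_norm_sq, show ‖u‖ = 1 from ho.1 1, one_pow]
  have huv : inner ℝ u v = (0 : ℝ) := ho.2 (i := 1) (j := 0) (by decide)
  let A (a : Set.powersetCard (Fin n) 2) (w : Euc n) : Euc n :=
    WithLp.toLp 2 ((wedgeToSO n (wedgeBasis n a) : Matrix (Fin n) (Fin n) ℝ).mulVec w)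
  -- The part of the test value that does not grow with `p`, after the common positive factor is
  -- removed.
  let T : ℝ := ∑ a, ∑ b, inner ℝ (R (wedgeBasis n a)) (wedgeBasis n b) *
    (inner ℝ (A a u) (A b u) + inner ℝ (A a v) (A b v))
  have key : ∀ p : ℕ, 0 ≤ T + 2 * (p + 1) * inner ℝ (R (wedge v u)) (wedge v u) := by
    intro p
    obtain ⟨hre, him⟩ := planePow_mem_Sym0 hu hv huv p
    have h0 := add_nonneg (h (p + 2) (by omega) ⟨_, hre⟩) (h (p + 2) (by omega) ⟨_, him⟩)
    have hQ : ∀ a b : Set.powersetCard (Fin n) 2,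
        fischer n (leibnizBasis a (planePow u v (p + 2)).1)
            (leibnizBasis b (planePow u v (p + 2)).1) +
          fischer n (leibnizBasis a (planePow u v (p + 2)).2)
            (leibnizBasis b (planePow u v (p + 2)).2) =
        ((p + 2) ^ 2 * (2 * (p + 1) * planePowSq u v p)) *
          ((inner ℝ (A a u) (A b u) + inner ℝ (A a v) (A b v)) + 2 * (p + 1) *
            (inner ℝ (wedgeBasis n a) (wedge v u) * inner ℝ (wedgeBasis n b) (wedge v u))) := by
      intro a b
      have hz : ∀ (a : Set.powersetCard (Fin n) 2) (w : Euc n), inner ℝ (A a w) w = (0 : ℝ) := by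
        intro a w
        rw [inner_mulVec_wedgeToSO, wedge_self, inner_zero_right]
      have hs : ∀ a : Set.powersetCard (Fin n) 2,
          inner ℝ (A a v) u = -inner ℝ (wedgeBasis n a) (wedge v u) := by
        intro a
        rw [inner_mulVec_wedgeToSO, inner_wedgeBasis_wedge_swap]
      have := fischer_rotated_planePow hu hv huv p (hz a u) (hz a v) (hz b u) (hz b v)
        (inner_mulVec_wedgeToSO a u v) (hs a) (inner_mulVec_wedgeToSO b u v) (hs b)
      simp only [leibnizBasis, (leibniz_planePow _ u v (p + 1)).1,
        (leibniz_planePow _ u v (p + 1)).2, fischer_C_mul, fischer_mul_C]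
      push_cast
      linear_combination ((p : ℝ) + 1 + 1) ^ 2 * this
    have hsum : symInner (curvatureTermSym0 R (p + 2) ⟨_, hre⟩).1 (planePow u v (p + 2)).1 +
        symInner (curvatureTermSym0 R (p + 2) ⟨_, him⟩).1 (planePow u v (p + 2)).2 =
        ((p + 2) ^ 2 * (2 * (p + 1) * planePowSq u v p)) *
          (T + 2 * (p + 1) * inner ℝ (R (wedge v u)) (wedge v u)) := by
      have e1 := symInner_curvatureTermSym0_self R (⟨_, hre⟩ : Sym0 n (p + 2))
      have e2 := symInner_curvatureTermSym0_self R (⟨_, him⟩ : Sym0 n (p + 2))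
      rw [e1, e2, ← sum_inner_wedgeBasis]
      simp only [T, Finset.mul_sum, ← Finset.sum_add_distrib]
      refine Finset.sum_congr rfl fun a _ => Finset.sum_congr rfl fun b _ => ?_
      rw [← mul_add, hQ]
      ring
    rw [hsum] at h0
    have hN := planePowSq_pos hu hv huv p
    exact nonneg_of_mul_nonneg_right h0 (by positivity)
  by_contra! hneg
  -- With `s < 0` the curvature and `T < -ps`, one gets `T + 2(p+1)s < (p+2)s < 0`, contradicting
  -- `key`.
  obtain ⟨p, hp⟩ := exists_nat_gt (T / (-inner ℝ (R (wedge v u)) (wedge v u)))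
  rw [div_lt_iff₀ (neg_pos.mpr hneg)] at hp
  have := key p
  have h1 : 0 ≤ (p : ℝ) := p.cast_nonneg
  nlinarith [mul_nonneg h1 (neg_pos.mpr hneg).le]

/-! ### General `k` and the passage to upper bounds. -/

theorem secGE_iff_isPosSemidef {n : ℕ} {R : Module.End ℝ (Wedge2 n)} (hR : R.IsSymmetric)
    (k : ℝ) : SecGE R k ↔
      ∀ p : ℕ, 2 ≤ p → IsPosSemidef (curvatureTermSym0 (R - k • LinearMap.id) p) := by
  have hS : (R - k • LinearMap.id).IsSymmetric := by
    intro σ τ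
    rw [LinearMap.sub_apply, LinearMap.sub_apply, inner_sub_left, inner_sub_right, hR,
      LinearMap.smul_apply, LinearMap.smul_apply, LinearMap.id_apply, LinearMap.id_apply,
      inner_smul_left_wedge, inner_smul_right_wedge]
  rw [← secGE_sub_smul_iff]
  exact ⟨fun h p _ => ⟨symInner_curvatureTermSym0_comm hS, h.symInner_curvatureTermSym0_nonneg⟩,
    fun h => SecGE.of_symInner_nonneg fun p hp => (h p hp).2⟩

theorem secLE_iff_secGE_neg {n : ℕ} (R : Module.End ℝ (Wedge2 n)) (k : ℝ) :
    SecLE R k ↔ SecGE (-R) (-k) := by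
  refine forall₂_congr fun x y => forall_congr' fun _ => ?_
  rw [LinearMap.neg_apply, inner_neg_left, neg_le_neg_iff]

theorem curvatureTermSym0_neg {n : ℕ} (R : Module.End ℝ (Wedge2 n)) (p : ℕ) :
    curvatureTermSym0 (-R) p = -curvatureTermSym0 R p := by
  refine LinearMap.ext fun φ => Subtype.ext ?_
  rw [LinearMap.neg_apply, Submodule.coe_neg, curvatureTermSym0_coe, curvatureTermSym0_coe]
  simp

theorem isPosSemidef_neg_iff {n p : ℕ} (T : Module.End ℝ (Sym0 n p)) :
    IsPosSemidef (-T) ↔ IsNegSemidef T := by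
  simp only [IsPosSemidef, IsNegSemidef, LinearMap.neg_apply, Submodule.coe_neg,
    symInner_eq_fischer, map_neg, LinearMap.neg_apply, neg_inj, Left.nonneg_neg_iff]

end WeitzenbockSym

end

theorem theoremA (n : ℕ) (R : Module.End ℝ (⋀[ℝ]^2 (EuclideanSpace ℝ (Fin n))))
    (hR : LinearMap.IsSymmetric R) (k : ℝ) :
    (WeitzenbockSym.SecGE R k ↔
      ∀ p : ℕ, 2 ≤ p → WeitzenbockSym.IsPosSemidef
        (WeitzenbockSym.curvatureTermSym0 (R - k • LinearMap.id) p)) ∧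
    (WeitzenbockSym.SecLE R k ↔
      ∀ p : ℕ, 2 ≤ p → WeitzenbockSym.IsNegSemidef
        (WeitzenbockSym.curvatureTermSym0 (R - k • LinearMap.id) p)) := by
  refine ⟨WeitzenbockSym.secGE_iff_isPosSemidef hR k, ?_⟩
  have hR' : LinearMap.IsSymmetric (-R) := fun σ τ => by
    rw [LinearMap.neg_apply, LinearMap.neg_apply, inner_neg_left, inner_neg_right, hR]
  have hneg : -R - (-k) • LinearMap.id = -(R - k • LinearMap.id) := by
    refine LinearMap.ext fun σ => ?_
    simp only [LinearMap.sub_apply, LinearMap.neg_apply, LinearMap.smul_apply, LinearMap.id_apply]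
    module
  rw [WeitzenbockSym.secLE_iff_secGE_neg, WeitzenbockSym.secGE_iff_isPosSemidef hR', hneg]
  simp only [WeitzenbockSym.curvatureTermSym0_neg, WeitzenbockSym.isPosSemidef_neg_iff]
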